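/- Let $\mathfrak{sl}_2$ be the Lie algebra of traceless complex $2\times 2$ matrices with the bilinear form $(\xi,\eta)=2\operatorname{Tr}(\xi\eta)$ and its orthonormal basis $$x_1=\tfrac12\begin{pmatrix}0&1\\1&0\end{pmatrix},\qquad x_2=\tfrac12\begin{pmatrix}0&-i\\i&0\end{pmatrix},\qquad x_3=\tfrac12\begin{pmatrix}1&0\\0&-1\end{pmatrix},$$ and let $c=x_1^2+x_2^2+x_3^2\in U(\mathfrak{sl}_2)$. A chord diagram on two strands is an ordered pair of oriented lines (strands) with $2n$ distinct points on them ($n\ge 0$), split into $n$ pairs (chords), considered up to orientation-preserving diffeomorphisms of each strand. Let $A_2$ be the complex vector space with basis the set of all chord diagrams on two strands. The $\mathfrak{sl}_2$ weight system is the linear map $w_{\mathfrak{sl}_2}\colon A_2\to U(\mathfrak{sl}_2)\otimes_{\mathbb C} U(\mathfrak{sl}_2)$ whose value on a diagram $D$ is $$w_{\mathfrak{sl}_2}(D)=\sum_{m}P_1(m)\otimes P_2(m),$$ where $m$ runs over all maps from the set of chords of $D$ to $\{1,2,3\}$, and $P_s(m)\in U(\mathfrak{sl}_2)$ is the product, in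 the order along the $s$-th strand, of the elements obtained by writing $x_{m(a)}$ at both ends of every chord $a$ (an empty product is $1$). Theorem. Put $$c_1=c\otimes 1,\qquad c_2=1\otimes c,\qquad x=x_1\otimes x_1+x_2\otimes x_2+x_3\otimes x_3 .$$ Then the image of $w_{\mathfrak{sl}_2}$ is the subalgebra of $U(\mathfrak{sl}_2)\otimes U(\mathfrak{sl}_2)$ generated by $c_1,c_2,x$, and this subalgebra is the polynomial ring $\mathbb C[c_1,c_2,x]$: the three generators commute and are algebraically independent over $\mathbb C$, so there is an isomorphism of algebras from the polynomial ring in three variables onto the image of $w_{\mathfrak{sl}_2}$ that sends the variables to $c_1,c_2,x$. -/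

import Mathlib

open scoped TensorProduct

noncomputable section

/-- A chord diagram on `k` oriented strands, up to orientation-preserving diffeomorphisms of each
strand: strand `i` carries `points i` endpoints, numbered along its orientation, and all endpoints
together are split into pairs by a fixed-point-free involution. -/
structure ChordDiagram (k : ℕ) where
  /-- the number of chord endpoints on each strand -/
  points : Fin k → ℕ
  /-- the other end of the chord at a given endpoint -/
  partner : Equiv.Perm (Σ i : Fin k, Fin (points i))
  partner_partner : ∀ p, partner (partner p) = p
  partner_ne : ∀ p, partner p ≠ p

namespace ChordDiagram

variable {k : ℕ}

/-- The endpoints of the chords: `⟨i, j⟩` is the `j`-th endpoint on strand `i`. -/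
abbrev Endpoint (D : ChordDiagram k) : Type := Σ i : Fin k, Fin (D.points i)

/-- The chords: the two-element orbits of the involution. -/
def Chord (D : ChordDiagram k) : Type := Quotient (Equiv.Perm.SameCycle.setoid D.partner)

/-- The chord that has a given endpoint. -/
def chordAt (D : ChordDiagram k) (p : D.Endpoint) : D.Chord :=
  Quotient.mk (Equiv.Perm.SameCycle.setoid D.partner) p

instance (D : ChordDiagram k) : Finite D.Chord :=
  inferInstanceAs (Finite (Quotient (Equiv.Perm.SameCycle.setoid D.partner)))

instance (D : ChordDiagram k) : Fintype D.Chord := Fintype.ofFinite _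

instance (D : ChordDiagram k) : DecidableEq D.Chord := Classical.decEq _

/-- The vector space `A_k` of formal complex linear combinations of chord diagrams on `k`
strands. -/
abbrev Space (k : ℕ) : Type := ChordDiagram k →₀ ℂ

section WeightSystem

variable {L : Type*} [LieRing L] [LieAlgebra ℂ L] {d : ℕ}

/-- The product along strand `i`, in the direction of the strand, of the elements `b (m c)` placed
at both ends of every chord `c`. -/
def strandProduct (b : Fin d → L) (D : ChordDiagram k) (m : D.Chord → Fin d) (i : Fin k) :
    UniversalEnvelopingAlgebra ℂ L :=
  (List.ofFn fun j : Fin (D.points i) =>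
    UniversalEnvelopingAlgebra.ι ℂ (b (m (D.chordAt ⟨i, j⟩)))).prod

/-- The value on one chord diagram on two strands of the weight system built from `b`: the sum over
all maps from the chords to the indices of the tensor product of the two strand products. -/
def weight (b : Fin d → L) (D : ChordDiagram 2) :
    UniversalEnvelopingAlgebra ℂ L ⊗[ℂ] UniversalEnvelopingAlgebra ℂ L :=
  ∑ m : D.Chord → Fin d, strandProduct b D m 0 ⊗ₜ[ℂ] strandProduct b D m 1

/-- The linear extension of `weight` to the space of chord diagrams on two strands. For an
orthonormal basis `b` of `L` this is the Lie algebra weight system of `L`. -/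
def weightSystem (b : Fin d → L) :
    Space 2 →ₗ[ℂ] UniversalEnvelopingAlgebra ℂ L ⊗[ℂ] UniversalEnvelopingAlgebra ℂ L :=
  Finsupp.linearCombination ℂ (weight b)

end WeightSystem

end ChordDiagram

/-- The Lie algebra of traceless complex `2 × 2` matrices. -/
abbrev Sl2 : Type := LieAlgebra.SpecialLinear.sl (Fin 2) ℂ

/-- The universal enveloping algebra `U(sl₂)`. -/
abbrev USl2 : Type := UniversalEnvelopingAlgebra ℂ Sl2

namespace Sl2

/-- The three matrices of the standard orthonormal basis, halves of the Pauli matrices. -/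
def pauliHalf : Fin 3 → Matrix (Fin 2) (Fin 2) ℂ :=
  ![(1 / 2 : ℂ) • !![0, 1; 1, 0],
    (1 / 2 : ℂ) • !![0, -Complex.I; Complex.I, 0],
    (1 / 2 : ℂ) • !![1, 0; 0, -1]]

theorem trace_pauliHalf (a : Fin 3) : (pauliHalf a).trace = 0 := by
  fin_cases a <;> simp [pauliHalf, Matrix.trace_fin_two]

/-- The basis `x₁, x₂, x₃` of `sl₂`. -/
def basis (a : Fin 3) : Sl2 :=
  ⟨pauliHalf a, (LinearMap.mem_ker).2 (trace_pauliHalf a)⟩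

/-- The basis is orthonormal for the form `(ξ, η) = 2 Tr (ξ η)`. -/
theorem basis_orthonormal (a b : Fin 3) :
    2 * ((basis a).val * (basis b).val).trace = if a = b then 1 else 0 := by
  fin_cases a <;> fin_cases b <;>
    simp [basis, pauliHalf, Matrix.trace_fin_two] <;> ring_nf; simp

/-- The image of `x_a` in `U(sl₂)`. -/
def gen (a : Fin 3) : USl2 := UniversalEnvelopingAlgebra.ι ℂ (basis a)

/-- The Casimir element `c = x₁² + x₂² + x₃²`. -/
def casimir : USl2 := ∑ a, gen a ^ 2

/-- `c₁ = c ⊗ 1`. -/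
def c₁ : USl2 ⊗[ℂ] USl2 := casimir ⊗ₜ[ℂ] 1

/-- `c₂ = 1 ⊗ c`. -/
def c₂ : USl2 ⊗[ℂ] USl2 := 1 ⊗ₜ[ℂ] casimir

/-- `x = x₁ ⊗ x₁ + x₂ ⊗ x₂ + x₃ ⊗ x₃`. -/
def x : USl2 ⊗[ℂ] USl2 := ∑ a, gen a ⊗ₜ[ℂ] gen a

/-- The `sl₂` weight system on chord diagrams on two strands. -/
def weightSystem : ChordDiagram.Space 2 →ₗ[ℂ] USl2 ⊗[ℂ] USl2 :=
  ChordDiagram.weightSystem basis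

end Sl2

end

/-! Upper bound. Attach to each strand the matrix `L_s = ∑ σ_a ⊗ x_a` (`lax`) of Pauli matrices with
entries in the `s`-th tensor factor. As `Tr(σ_a σ_b) = 2δ_ab`, the sum over the label of a chord is,
up to a factor 2, a sum over matrix indices at its two ends. So the weight of a diagram is a
multiple of a contracted word in entries of `L_0, L_1`, each index occurring once as a row and once
as a column (`sum_prod_leg_mem`). If letters could be reordered freely, such a word would be a
product of traces of words in `L_0, L_1`. Exchanging neighbours costs only balanced words of lower
degree (`lax_entry_commutator`), so induction applies (`contraction_mem`). The relations `L_s² = c_s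
- L_s` and `L_0 L_1 + L_1 L_0 = 2x` reduce every matrix product to `1, L_0, L_1, L_0 L_1`, with
traces `2, 0, 0, 2x`.

Lower bound. Isolated chords and parallel chords realise every monomial `c₁^a c₂^b x^k`
(`weight_monomialEquiv`).

Independence. On a tensor product of two representations of highest weights `l, m`, realised on
polynomials in `y_0, y_1`, the vectors `(y_0 - y_1)^k` are common eigenvectors of `c₁, c₂, x`
(`diffRepTensor_x`). The eigenvalue of `x` is quadratic in `k`, so a relation valid for all natural
`k` holds for complex `k`, and then the three eigenvalues take all values in `ℂ³`
(`algHom_injective`). -/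

noncomputable section

/-! ### Commutation relations and the matrices `L_s` -/

namespace Sl2

theorem basis_lie_zero_one : ⁅basis 0, basis 1⁆ = Complex.I • basis 2 := by
  ext i j
  fin_cases i <;> fin_cases j <;>
    simp [basis, pauliHalf, Ring.lie_def] <;> ring

theorem basis_lie_one_two : ⁅basis 1, basis 2⁆ = Complex.I • basis 0 := by
  ext i j
  fin_cases i <;> fin_cases j <;>
    simp [basis, pauliHalf, Ring.lie_def] <;> ring

theorem basis_lie_two_zero : ⁅basis 2, basis 0⁆ = Complex.I • basis 1 := by
  ext i j
  fin_cases i <;> fin_cases j <;>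
    simp [basis, pauliHalf, Ring.lie_def] <;> ring_nf <;> simp <;> norm_num

section

attribute [local instance 100] LieRing.ofAssociativeRing

theorem gen_zero_mul_gen_one : gen 0 * gen 1 = gen 1 * gen 0 + Complex.I • gen 2 := by
  have h := congrArg (UniversalEnvelopingAlgebra.ι ℂ) basis_lie_zero_one
  rw [LieHom.map_lie, map_smul, LieRing.of_associative_ring_bracket] at h
  exact sub_eq_iff_eq_add'.1 h

theorem gen_one_mul_gen_two : gen 1 * gen 2 = gen 2 * gen 1 + Complex.I • gen 0 := by
  have h := congrArg (UniversalEnvelopingAlgebra.ι ℂ) basis_lie_one_two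
  rw [LieHom.map_lie, map_smul, LieRing.of_associative_ring_bracket] at h
  exact sub_eq_iff_eq_add'.1 h

theorem gen_zero_mul_gen_two : gen 0 * gen 2 = gen 2 * gen 0 - Complex.I • gen 1 := by
  have h := congrArg (UniversalEnvelopingAlgebra.ι ℂ) basis_lie_two_zero
  rw [LieHom.map_lie, map_smul, LieRing.of_associative_ring_bracket] at h
  rw [eq_sub_iff_add_eq']
  exact (sub_eq_iff_eq_add.1 h).symm

end

/-- The generator `gen a` acting on the tensor factor `s`. -/
def leg (s : Fin 2) (a : Fin 3) : USl2 ⊗[ℂ] USl2 :=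
  if s = 0 then gen a ⊗ₜ 1 else 1 ⊗ₜ gen a

theorem leg_zero (a : Fin 3) : leg 0 a = gen a ⊗ₜ 1 := rfl

theorem leg_one (a : Fin 3) : leg 1 a = 1 ⊗ₜ gen a := rfl

theorem leg_zero_mul_one (s : Fin 2) :
    leg s 0 * leg s 1 = leg s 1 * leg s 0 + Complex.I • leg s 2 := by
  fin_cases s
  · simp [leg_zero, gen_zero_mul_gen_one, TensorProduct.add_tmul, TensorProduct.smul_tmul']
  · simp [leg_one, gen_zero_mul_gen_one, TensorProduct.tmul_add]

theorem leg_one_mul_two (s : Fin 2) :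
    leg s 1 * leg s 2 = leg s 2 * leg s 1 + Complex.I • leg s 0 := by
  fin_cases s
  · simp [leg_zero, gen_one_mul_gen_two, TensorProduct.add_tmul, TensorProduct.smul_tmul']
  · simp [leg_one, gen_one_mul_gen_two, TensorProduct.tmul_add]

theorem leg_zero_mul_two (s : Fin 2) :
    leg s 0 * leg s 2 = leg s 2 * leg s 0 - Complex.I • leg s 1 := by
  fin_cases s
  · simp [leg_zero, gen_zero_mul_gen_two, TensorProduct.sub_tmul, TensorProduct.smul_tmul']
  · simp [leg_one, gen_zero_mul_gen_two, TensorProduct.tmul_sub]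

theorem leg_zero_comm_leg_one (a b : Fin 3) : leg 1 a * leg 0 b = leg 0 b * leg 1 a := by
  simp [leg_zero, leg_one]

/-- The Casimir element of the tensor factor `s`. -/
def legCasimir (s : Fin 2) : USl2 ⊗[ℂ] USl2 := ∑ a, leg s a ^ 2

theorem legCasimir_zero : legCasimir 0 = c₁ := by
  simp [legCasimir, c₁, casimir, leg_zero, TensorProduct.sum_tmul]

theorem legCasimir_one : legCasimir 1 = c₂ := by
  simp [legCasimir, c₂, casimir, leg_one, TensorProduct.tmul_sum]

theorem x_eq_sum_leg : x = ∑ a, leg 0 a * leg 1 a := by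
  simp [x, leg_zero, leg_one]

theorem legCasimir_commute_leg_self (s : Fin 2) (a : Fin 3) :
    Commute (legCasimir s) (leg s a) := by
  have h01 := leg_zero_mul_one s
  have h12 := leg_one_mul_two s
  have h02 := leg_zero_mul_two s
  -- Together with the unprimed relations, these sort every right-associated monomial into
  -- decreasing order of indices.
  have h01' : ∀ z, leg s 0 * (leg s 1 * z) = leg s 1 * (leg s 0 * z) + Complex.I • (leg s 2 * z) := by
    intro z; rw [← mul_assoc, h01, add_mul, mul_assoc, smul_mul_assoc]
  have h12' : ∀ z, leg s 1 * (leg s 2 * z) = leg s 2 * (leg s 1 * z) + Complex.I • (leg s 0 * z) := by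
    intro z; rw [← mul_assoc, h12, add_mul, mul_assoc, smul_mul_assoc]
  have h02' : ∀ z, leg s 0 * (leg s 2 * z) = leg s 2 * (leg s 0 * z) - Complex.I • (leg s 1 * z) := by
    intro z; rw [← mul_assoc, h02, sub_mul, mul_assoc, smul_mul_assoc]
  rw [commute_iff_eq, legCasimir, Fin.sum_univ_three]
  fin_cases a <;>
    simp only [Fin.zero_eta, Fin.mk_one, Fin.reduceFinMk, pow_two, add_mul, mul_add, mul_assoc,
      h01, h12, h02, h01', h12', h02', mul_sub, smul_add, smul_sub, mul_smul_comm] <;> abel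

theorem legCasimir_commute_leg (s t : Fin 2) (a : Fin 3) : Commute (legCasimir s) (leg t a) := by
  by_cases h : s = t
  · subst h; exact legCasimir_commute_leg_self s a
  · refine Commute.sum_left _ _ _ fun b _ => Commute.pow_left ?_ 2
    fin_cases s <;> fin_cases t <;> simp at h
    · exact (leg_zero_comm_leg_one a b).symm
    · exact leg_zero_comm_leg_one b a

theorem commute_c₁_c₂ : Commute c₁ c₂ := by
  simp [commute_iff_eq, c₁, c₂]

theorem commute_c₁_x : Commute c₁ x := by
  rw [← legCasimir_zero, x_eq_sum_leg]
  exact Commute.sum_right _ _ _ fun a _ =>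
    (legCasimir_commute_leg 0 0 a).mul_right (legCasimir_commute_leg 0 1 a)

theorem commute_c₂_x : Commute c₂ x := by
  rw [← legCasimir_one, x_eq_sum_leg]
  exact Commute.sum_right _ _ _ fun a _ =>
    (legCasimir_commute_leg 1 0 a).mul_right (legCasimir_commute_leg 1 1 a)

/-- The matrix `∑ a, σ_a ⊗ x_a` with entries in the tensor factor `s`, where `σ_a` are the Pauli
matrices. -/
def lax (s : Fin 2) : Matrix (Fin 2) (Fin 2) (USl2 ⊗[ℂ] USl2) :=
  fun u v => ∑ a, (2 * pauliHalf a u v) • leg s a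

theorem lax_zero_zero (s : Fin 2) : lax s 0 0 = leg s 2 := by
  simp [lax, pauliHalf, Fin.sum_univ_three]

theorem lax_zero_one (s : Fin 2) : lax s 0 1 = leg s 0 - Complex.I • leg s 1 := by
  simp [lax, pauliHalf, Fin.sum_univ_three, sub_eq_add_neg]

theorem lax_one_zero (s : Fin 2) : lax s 1 0 = leg s 0 + Complex.I • leg s 1 := by
  simp [lax, pauliHalf, Fin.sum_univ_three]

theorem lax_one_one (s : Fin 2) : lax s 1 1 = - leg s 2 := by
  simp [lax, pauliHalf, Fin.sum_univ_three]

theorem trace_lax (s : Fin 2) : (lax s).trace = 0 := by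
  simp [Matrix.trace_fin_two, lax_zero_zero, lax_one_one]

/-- From `σ_a σ_b = δ_ab + i ε_abc σ_c`: the diagonal terms give the Casimir element, the
antisymmetric ones give commutators `[x_a, x_b]`, which add up to `-L_s`. -/
theorem lax_mul_self (s : Fin 2) : lax s * lax s = legCasimir s • 1 - lax s := by
  ext u v
  fin_cases u <;> fin_cases v <;>
    simp [Matrix.mul_apply, Fin.sum_univ_two, lax_zero_zero, lax_zero_one, lax_one_zero,
      lax_one_one, legCasimir, Fin.sum_univ_three, pow_two, mul_add, add_mul, mul_sub, sub_mul,
      leg_zero_mul_one, leg_zero_mul_two, leg_one_mul_two, smul_add, smul_sub, smul_smul] <;> abel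

/-- Entries from different tensor factors commute, so only the anticommutators `σ_a σ_b + σ_b σ_a =
2δ_ab` of the Pauli matrices remain. -/
theorem lax_anticommutator : lax 0 * lax 1 + lax 1 * lax 0 = (2 * x) • 1 := by
  ext u v
  fin_cases u <;> fin_cases v <;>
    simp [Matrix.mul_apply, Fin.sum_univ_two, lax_zero_zero, lax_zero_one, lax_one_zero,
      lax_one_one, x_eq_sum_leg, Fin.sum_univ_three, mul_add, add_mul, mul_sub, sub_mul,
      leg_zero_comm_leg_one, smul_add, smul_sub, smul_smul, two_mul] <;> abel

theorem lax_entry_commute (a b c d : Fin 2) : Commute (lax 0 a b) (lax 1 c d) := by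
  refine Commute.sum_left _ _ _ fun i _ => Commute.sum_right _ _ _ fun j _ => ?_
  exact ((show Commute (leg 0 i) (leg 1 j) from
    (leg_zero_comm_leg_one j i).symm).smul_left _).smul_right _

/-- These are relations of `gl₂` type: the right side has degree one, and the Kronecker deltas keep
the same row labels and the same column labels. Both facts drive the induction on degree. -/
theorem lax_entry_commutator (s a b c d : Fin 2) :
    lax s a b * lax s c d - lax s c d * lax s a b =
      (1 : Matrix (Fin 2) (Fin 2) (USl2 ⊗[ℂ] USl2)) a d * lax s c b -
        (1 : Matrix (Fin 2) (Fin 2) (USl2 ⊗[ℂ] USl2)) c b * lax s a d := by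
  fin_cases a <;> fin_cases b <;> fin_cases c <;> fin_cases d <;>
    simp [lax_zero_zero, lax_zero_one, lax_one_zero,
      lax_one_one, mul_add, add_mul, mul_sub, sub_mul,
      leg_zero_mul_one, leg_zero_mul_two, leg_one_mul_two, smul_add, smul_sub, smul_smul] <;>
    abel

end Sl2

/-- Swapping the value at `q` with a dummy value is an involution of `(ι → κ) × κ`. This sums out
one index without splitting the function space, at the price of the factor `card κ`. -/
theorem Fintype.card_nsmul_sum_eq_sum_update {ι κ M : Type*} [Fintype ι] [DecidableEq ι]
    [Fintype κ] [AddCommMonoid M] (q : ι) (F : (ι → κ) → M) :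
    Fintype.card κ • ∑ i, F i = ∑ i : ι → κ, ∑ b, F (Function.update i q b) := by
  have h : Function.Involutive
      fun z : (ι → κ) × κ => (Function.update z.1 q z.2, z.1 q) := by
    rintro ⟨i, b⟩
    simp
  rw [← Fintype.sum_prod_type' (f := fun i b => F (Function.update i q b))]
  calc Fintype.card κ • ∑ i, F i = ∑ z : (ι → κ) × κ, F z.1 := by
        simp [Fintype.sum_prod_type, Finset.smul_sum]
    _ = _ := (Equiv.sum_comp h.toPerm fun z : (ι → κ) × κ => F z.1).symm

/-! ### Reducing matrix products of `L_0` and `L_1` -/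

namespace Sl2

/-- The subalgebra generated by `c₁, c₂, x`. -/
def casimirAlgebra : Subalgebra ℂ (USl2 ⊗[ℂ] USl2) := Algebra.adjoin ℂ {c₁, c₂, x}

theorem c₁_mem : c₁ ∈ casimirAlgebra := Algebra.subset_adjoin (by simp)

theorem c₂_mem : c₂ ∈ casimirAlgebra := Algebra.subset_adjoin (by simp)

theorem x_mem : x ∈ casimirAlgebra := Algebra.subset_adjoin (by simp)

/-- The matrices that are combinations of `1, L₀, L₁, L₀ L₁` with coefficients in the algebra
generated by `c₁, c₂, x`, where `L_s = lax s`. -/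
def laxModule : Set (Matrix (Fin 2) (Fin 2) (USl2 ⊗[ℂ] USl2)) :=
  {M | ∃ a ∈ casimirAlgebra, ∃ b ∈ casimirAlgebra, ∃ c ∈ casimirAlgebra, ∃ d ∈ casimirAlgebra,
    M = a • 1 + b • lax 0 + c • lax 1 + d • (lax 0 * lax 1)}

theorem trace_mem_of_mem_laxModule {M : Matrix (Fin 2) (Fin 2) (USl2 ⊗[ℂ] USl2)}
    (hM : M ∈ laxModule) : M.trace ∈ casimirAlgebra := by
  obtain ⟨a, ha, b, hb, c, hc, d, hd, rfl⟩ := hM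
  have h : (lax 0 * lax 1).trace = 2 * x := by
    simp [Matrix.trace_fin_two, Matrix.mul_apply, Fin.sum_univ_two, lax_zero_zero, lax_zero_one,
      lax_one_zero, lax_one_one, x_eq_sum_leg, Fin.sum_univ_three, mul_add, add_mul, mul_sub,
      sub_mul, smul_smul, smul_add, smul_sub, two_mul]
    abel
  have h2 : (2 : USl2 ⊗[ℂ] USl2) ∈ casimirAlgebra := ofNat_mem _ 2
  have : (a • 1 + b • lax 0 + c • lax 1 + d • (lax 0 * lax 1)).trace = a * 2 + d * (2 * x) := by
    rw [Matrix.trace_add, Matrix.trace_add, Matrix.trace_add, Matrix.trace_smul, Matrix.trace_smul,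
      Matrix.trace_smul, Matrix.trace_smul, trace_lax, trace_lax, h, Matrix.trace_one]
    simp
  rw [this]
  exact add_mem (mul_mem ha h2) (mul_mem hd (mul_mem h2 x_mem))

/-- `x` does not commute with the entries of `L_0`. Writing `2x = L_0 L_1 + L_1 L_0`, the commutator
is `L_0² L_1 - L_1 L_0²`, which `L_0² = c₁ - L_0` turns into `L_1 L_0 - L_0 L_1 = 2x - 2 L_0 L_1`.
-/
theorem lax_zero_mul_smul_x : lax 0 * ((2 * x) • 1) =
    (2 * x) • lax 0 + (2 * x) • 1 - (2 : USl2 ⊗[ℂ] USl2) • (lax 0 * lax 1) := by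
  have hc : (legCasimir 0 • (1 : Matrix (Fin 2) (Fin 2) (USl2 ⊗[ℂ] USl2))) * lax 1 =
      lax 1 * (legCasimir 0 • 1) := by
    ext u v
    simp only [Matrix.mul_apply, Matrix.smul_apply, Matrix.one_apply, smul_eq_mul]
    simp only [mul_ite, mul_one, mul_zero, ite_mul, zero_mul, Finset.sum_ite_eq,
      Finset.sum_ite_eq', Finset.mem_univ, if_true]
    exact Commute.sum_right _ _ _ fun a _ => (legCasimir_commute_leg 0 1 a).smul_right _
  have h2 : (2 * x) • lax 0 = ((2 * x) • 1) * lax 0 := by rw [smul_mul_assoc, one_mul]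
  have h3 : (2 : USl2 ⊗[ℂ] USl2) • (lax 0 * lax 1) = lax 0 * lax 1 + lax 0 * lax 1 := two_smul _ _
  have h0 := lax_mul_self 0
  rw [h2, h3, ← lax_anticommutator, mul_add, add_mul, ← mul_assoc, mul_assoc (lax 1), h0, sub_mul,
    mul_sub, hc]
  noncomm_ring

/-- Coefficients stay on the left, so only `L_s²`, `L_1 L_0`, `L_0 L_1 L_0` and `L_0 L_1²` need to
be rewritten. -/
theorem mul_lax_mem_laxModule {M : Matrix (Fin 2) (Fin 2) (USl2 ⊗[ℂ] USl2)}
    (hM : M ∈ laxModule) (s : Fin 2) : M * lax s ∈ laxModule := by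
  obtain ⟨a, ha, b, hb, c, hc, d, hd, rfl⟩ := hM
  have hx2 : 2 * x ∈ casimirAlgebra := mul_mem (ofNat_mem _ 2) x_mem
  have h10 : lax 1 * lax 0 = (2 * x) • 1 - lax 0 * lax 1 := by
    rw [← lax_anticommutator]; abel
  fin_cases s
  · refine ⟨b * c₁ + c * (2 * x) + d * (2 * x), add_mem (add_mem (mul_mem hb c₁_mem)
      (mul_mem hc hx2)) (mul_mem hd hx2), a - b + d * (2 * x), add_mem (sub_mem ha hb)
      (mul_mem hd hx2), -(d * c₁), neg_mem (mul_mem hd c₁_mem), -c - d,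
      sub_mem (neg_mem hc) hd, ?_⟩
    have h010 : lax 0 * lax 1 * lax 0 = (2 * x) • 1 + (2 * x) • lax 0 - c₁ • lax 1 -
        lax 0 * lax 1 := by
      rw [mul_assoc, h10, mul_sub, lax_zero_mul_smul_x, ← mul_assoc, lax_mul_self, sub_mul,
        smul_mul_assoc, one_mul, legCasimir_zero, two_smul]
      abel
    simp only [Fin.zero_eta, add_mul, smul_mul_assoc, one_mul, h010, h10, lax_mul_self,
      legCasimir_zero, smul_sub, smul_add, smul_smul, add_smul, sub_smul, neg_smul]
    abel
  · refine ⟨c * c₂, mul_mem hc c₂_mem, d * c₂, mul_mem hd c₂_mem, a - c, sub_mem ha hc,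
      b - d, sub_mem hb hd, ?_⟩
    have hcc : lax 0 * (c₂ • 1) = c₂ • lax 0 := by
      ext u v
      simp only [Matrix.mul_apply, Matrix.smul_apply, Matrix.one_apply, smul_eq_mul, mul_ite,
        mul_one, mul_zero, Finset.sum_ite_eq', Finset.mem_univ, if_true, ← legCasimir_one]
      exact (Commute.sum_right _ _ _ fun a _ =>
        (legCasimir_commute_leg 1 0 a).smul_right _).symm
    simp only [Fin.mk_one, add_mul, smul_mul_assoc, one_mul, mul_assoc, lax_mul_self, mul_sub,
      legCasimir_one, smul_sub, smul_smul, sub_smul, hcc]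
    abel

/-- The matrix of a letter: the identity for `none` and `lax s` for `some s`. -/
def letterMatrix : Option (Fin 2) → Matrix (Fin 2) (Fin 2) (USl2 ⊗[ℂ] USl2)
  | none => 1
  | some s => lax s

theorem mul_letterMatrix_mem_laxModule {M : Matrix (Fin 2) (Fin 2) (USl2 ⊗[ℂ] USl2)}
    (hM : M ∈ laxModule) (t : Option (Fin 2)) : M * letterMatrix t ∈ laxModule := by
  cases t with
  | none => simpa [letterMatrix] using hM
  | some s => exact mul_lax_mem_laxModule hM s

theorem one_mem_laxModule : 1 ∈ laxModule :=
  ⟨1, one_mem _, 0, zero_mem _, 0, zero_mem _, 0, zero_mem _, by simp⟩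

theorem letterMatrix_mem_laxModule (t : Option (Fin 2)) : letterMatrix t ∈ laxModule := by
  simpa using mul_letterMatrix_mem_laxModule one_mem_laxModule t

/-! ### Contractions of balanced words -/

variable {ι : Type*}

/-- A word in matrix entries: the letter `(t, a, b)` stands for the `(a, b)` entry of
`letterMatrix t`. -/
abbrev LaxWord (ι : Type*) : Type _ := List (Option (Fin 2) × ι × ι)

namespace LaxWord

/-- The product of the letters of a word, with indices substituted for the labels. -/
def eval (w : LaxWord ι) (i : ι → Fin 2) : USl2 ⊗[ℂ] USl2 :=
  (w.map fun l => letterMatrix l.1 (i l.2.1) (i l.2.2)).prod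

/-- The number of letters that are not identity matrices. -/
def degree (w : LaxWord ι) : ℕ := w.countP fun l => l.1.isSome

/-- The labels occurring as row indices. -/
def rows (w : LaxWord ι) : List ι := w.map fun l => l.2.1

/-- The labels occurring as column indices. -/
def cols (w : LaxWord ι) : List ι := w.map fun l => l.2.2

/-- Together with a letter in row `p` and column `q`, every label that occurs does so exactly once
as a row and exactly once as a column. -/
def Balanced (p q : ι) (w : LaxWord ι) : Prop :=
  (p :: rows w).Nodup ∧ (p :: rows w).Perm (q :: cols w)

theorem eval_append (u w : LaxWord ι) (i : ι → Fin 2) : eval (u ++ w) i = eval u i * eval w i := by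
  simp [eval]

theorem eval_cons (l : Option (Fin 2) × ι × ι) (w : LaxWord ι) (i : ι → Fin 2) :
    eval (l :: w) i = letterMatrix l.1 (i l.2.1) (i l.2.2) * eval w i := by
  simp [eval]

theorem eval_update [DecidableEq ι] {w : LaxWord ι} {q : ι} (hr : q ∉ rows w) (hc : q ∉ cols w)
    (i : ι → Fin 2) (b : Fin 2) : eval w (Function.update i q b) = eval w i := by
  refine congrArg List.prod (List.map_congr_left fun l hl => ?_)
  have h1 : l.2.1 ≠ q := fun h => hr (List.mem_map.2 ⟨l, hl, h⟩)
  have h2 : l.2.2 ≠ q := fun h => hc (List.mem_map.2 ⟨l, hl, h⟩)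
  simp [Function.update_of_ne h1, Function.update_of_ne h2]

theorem Balanced.of_perm {p q : ι} {w w' : LaxWord ι} (hw : Balanced p q w)
    (hr : (rows w).Perm (rows w')) (hc : (cols w).Perm (cols w')) : Balanced p q w' :=
  ⟨(hr.cons p).nodup_iff.1 hw.1, (hr.cons p).symm.trans (hw.2.trans (hc.cons q))⟩

theorem Balanced.perm {p q : ι} {w w' : LaxWord ι} (hw : Balanced p q w) (h : w.Perm w') :
    Balanced p q w' :=
  hw.of_perm (h.map _) (h.map _)

theorem Balanced.tail {p q r : ι} {t : Option (Fin 2)} {w : LaxWord ι}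
    (hw : Balanced p q ((t, q, r) :: w)) : Balanced p r w := by
  obtain ⟨h1, h2⟩ := hw
  simp only [rows, cols, List.map_cons] at h1 h2
  refine ⟨?_, ?_⟩
  · exact h1.sublist (by simp [rows])
  · exact ((List.Perm.swap _ _ _).trans h2).cons_inv

theorem Balanced.tail_self {p q r : ι} {t : Option (Fin 2)} {w : LaxWord ι}
    (hw : Balanced p p ((t, q, r) :: w)) : Balanced q r w :=
  ⟨(List.nodup_cons.1 hw.1).2, hw.2.cons_inv⟩

variable [Fintype ι] [DecidableEq ι]

/-- The sum over all indices of an entry of `M` times a word. -/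
def contraction (M : Matrix (Fin 2) (Fin 2) (USl2 ⊗[ℂ] USl2)) (p q : ι) (w : LaxWord ι) :
    USl2 ⊗[ℂ] USl2 :=
  ∑ i : ι → Fin 2, M (i p) (i q) * eval w i

/-- Exchanging two neighbouring letters changes a contraction by contractions of lower degree. -/
theorem contraction_swap_sub_mem {d : ℕ}
    (IH : ∀ (w : LaxWord ι) M p q, M ∈ laxModule → Balanced p q w → degree w < d →
      contraction M p q w ∈ casimirAlgebra)
    (y z : Option (Fin 2) × ι × ι) (u v : LaxWord ι)
    (M : Matrix (Fin 2) (Fin 2) (USl2 ⊗[ℂ] USl2)) (p q : ι) (hM : M ∈ laxModule)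
    (hw : Balanced p q (u ++ y :: z :: v)) (hd : degree (u ++ y :: z :: v) ≤ d) :
    contraction M p q (u ++ y :: z :: v) - contraction M p q (u ++ z :: y :: v) ∈
      casimirAlgebra := by
  have key (hc : ∀ i : ι → Fin 2, Commute (letterMatrix y.1 (i y.2.1) (i y.2.2))
      (letterMatrix z.1 (i z.2.1) (i z.2.2))) : contraction M p q (u ++ y :: z :: v) =
        contraction M p q (u ++ z :: y :: v) := by
    refine Finset.sum_congr rfl fun i _ => ?_
    simp only [eval_append, eval_cons]
    rw [← mul_assoc (letterMatrix y.1 _ _), (hc i).eq, mul_assoc]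
  have hone : ∀ (a b : Fin 2) (r : USl2 ⊗[ℂ] USl2),
      Commute ((1 : Matrix (Fin 2) (Fin 2) (USl2 ⊗[ℂ] USl2)) a b) r := by
    intro a b r
    rw [Matrix.one_apply]
    split_ifs
    · exact Commute.one_left _
    · exact Commute.zero_left _
  obtain ⟨_ | s, a, b⟩ := y
  · rw [key fun i => hone _ _ _, sub_self]; exact zero_mem _
  obtain ⟨_ | t, a', b'⟩ := z
  · rw [key fun i => (hone _ _ _).symm, sub_self]; exact zero_mem _
  by_cases hst : s = t
  · subst hst
    -- The Kronecker deltas are kept as `none` letters, so no indices are identified and the words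
    -- stay balanced, with one nontrivial letter fewer.
    have e : contraction M p q (u ++ (some s, a, b) :: (some s, a', b') :: v) -
        contraction M p q (u ++ (some s, a', b') :: (some s, a, b) :: v) =
        contraction M p q (u ++ (none, a, b') :: (some s, a', b) :: v) -
        contraction M p q (u ++ (none, a', b) :: (some s, a, b') :: v) := by
      simp only [contraction, ← Finset.sum_sub_distrib]
      refine Finset.sum_congr rfl fun i _ => ?_
      simp only [eval_append, eval_cons, letterMatrix]
      have h := lax_entry_commutator s (i a) (i b) (i a') (i b')
      calc _ = M (i p) (i q) * (eval u i * ((lax s (i a) (i b) * lax s (i a') (i b') -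
            lax s (i a') (i b') * lax s (i a) (i b)) * eval v i)) := by
            simp only [mul_sub, sub_mul, mul_assoc]
        _ = _ := by rw [h]; simp only [mul_sub, sub_mul, mul_assoc]
    rw [e]
    have hdeg : degree (u ++ (some s, a, b) :: (some s, a', b') :: v) = degree u + degree v + 2 := by
      simp [degree]; omega
    refine sub_mem (IH _ M p q hM (hw.of_perm ?_ ?_) ?_) (IH _ M p q hM (hw.of_perm ?_ ?_) ?_)
    · simp [rows]
    · simpa [cols] using List.Perm.append_left _ (List.Perm.swap _ _ _)
    · simp [degree] at hdeg hd ⊢; omega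
    · simpa [rows] using List.Perm.append_left _ (List.Perm.swap _ _ _)
    · simp [cols]
    · simp [degree] at hdeg hd ⊢; omega
  · rw [key fun i => ?_, sub_self]; · exact zero_mem _
    fin_cases s <;> fin_cases t <;> simp at hst
    · exact lax_entry_commute _ _ _ _
    · exact (lax_entry_commute _ _ _ _).symm

/-- Permuting the letters changes a contraction by contractions of lower degree. -/
theorem contraction_sub_mem_of_perm {d : ℕ}
    (IH : ∀ (w : LaxWord ι) M p q, M ∈ laxModule → Balanced p q w → degree w < d →
      contraction M p q w ∈ casimirAlgebra)
    (M : Matrix (Fin 2) (Fin 2) (USl2 ⊗[ℂ] USl2)) (p q : ι) (hM : M ∈ laxModule)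
    {w w' : LaxWord ι} (h : w.Perm w') : ∀ u : LaxWord ι,
    Balanced p q (u ++ w) → degree (u ++ w) ≤ d →
    contraction M p q (u ++ w) - contraction M p q (u ++ w') ∈ casimirAlgebra := by
  induction h with
  | nil => intro u _ _; rw [sub_self]; exact zero_mem _
  | cons y _ ih => intro u hw hd; simpa using ih (u ++ [y]) (by simpa using hw) (by simpa using hd)
  | swap y z v => intro u hw hd; exact contraction_swap_sub_mem IH _ _ _ _ _ _ _ hM hw hd
  | trans h1 _ ih1 ih2 =>
    intro u hw hd
    have h1' := List.Perm.append_left u h1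
    rw [← sub_add_sub_cancel]
    exact add_mem (ih1 u hw hd) (ih2 u (hw.perm h1') ((h1'.countP_eq _).symm.trans_le hd))

theorem mem_of_two_nsmul_mem {r : USl2 ⊗[ℂ] USl2} (h : 2 • r ∈ casimirAlgebra) :
    r ∈ casimirAlgebra := by
  have := casimirAlgebra.smul_mem h (1 / 2 : ℂ)
  rwa [← Nat.cast_smul_eq_nsmul ℂ, smul_smul, Nat.cast_ofNat, one_div_mul_cancel two_ne_zero,
    one_smul] at this

/-- By balance the index `p` occurs only in `M`, so summing over it splits off `M.trace`. -/
theorem contraction_self_mem {M : Matrix (Fin 2) (Fin 2) (USl2 ⊗[ℂ] USl2)}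
    (hM : M ∈ laxModule) {p : ι} {w : LaxWord ι} (hw : Balanced p p w)
    (h : ∑ i, eval w i ∈ casimirAlgebra) : contraction M p p w ∈ casimirAlgebra := by
  refine mem_of_two_nsmul_mem ?_
  have hr : p ∉ rows w := (List.nodup_cons.1 hw.1).1
  have hc : p ∉ cols w := (List.nodup_cons.1 (hw.2.nodup_iff.1 hw.1)).1
  have e := Fintype.card_nsmul_sum_eq_sum_update p fun i => M (i p) (i p) * eval w i
  rw [Fintype.card_fin] at e
  rw [contraction, e]
  simp only [Function.update_self, eval_update hr hc, ← Finset.sum_mul, ← Finset.mul_sum]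
  exact mul_mem (trace_mem_of_mem_laxModule hM) h

/-- The index `q` occurs only as the column of `M` and the row of the first letter, so summing over
it is a matrix multiplication. -/
theorem two_nsmul_contraction_cons (M : Matrix (Fin 2) (Fin 2) (USl2 ⊗[ℂ] USl2))
    {p q r : ι} {t : Option (Fin 2)} {w : LaxWord ι} (hpq : p ≠ q)
    (hw : Balanced p q ((t, q, r) :: w)) :
    2 • contraction M p q ((t, q, r) :: w) = contraction (M * letterMatrix t) p r w := by
  have hr : q ∉ rows w := (List.nodup_cons.1 (List.nodup_cons.1 hw.1).2).1
  have hc := (List.nodup_cons.1 (hw.2.nodup_iff.1 hw.1)).1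
  simp only [cols, List.map_cons, List.mem_cons, not_or] at hc
  have e := Fintype.card_nsmul_sum_eq_sum_update q fun i => M (i p) (i q) * eval ((t, q, r) :: w) i
  rw [Fintype.card_fin] at e
  rw [contraction, e]
  simp only [eval_cons, Function.update_self, Function.update_of_ne hpq,
    Function.update_of_ne (Ne.symm hc.1), eval_update hr hc.2, ← mul_assoc, ← Finset.sum_mul]
  rfl

/-- Contractions of balanced words lie in the algebra generated by `c₁, c₂, x`. -/
theorem contraction_mem (w : LaxWord ι)
    (M : Matrix (Fin 2) (Fin 2) (USl2 ⊗[ℂ] USl2)) (p q : ι) (hM : M ∈ laxModule)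
    (hw : Balanced p q w) : contraction M p q w ∈ casimirAlgebra := by
  induction hd : degree w using Nat.strong_induction_on generalizing w M p q with
  | _ d IH =>
  replace IH : ∀ (w : LaxWord ι) M p q, M ∈ laxModule → Balanced p q w → degree w < d →
      contraction M p q w ∈ casimirAlgebra := fun w M p q hM hw hlt => IH _ hlt w M p q hM hw rfl
  -- An inequality suffices, and lets the inner induction on length pass to words of smaller degree.
  replace hd := hd.le
  induction hn : w.length generalizing w M p q with
  | zero =>
    obtain rfl := List.length_eq_zero_iff.1 hn
    obtain rfl : p = q := by simpa [rows, cols] using hw.2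
    refine contraction_self_mem hM hw ?_
    simp only [eval, List.map_nil, List.prod_nil]
    exact sum_mem fun _ _ => one_mem _
  | succ n ih =>
    by_cases hpq : p = q
    · subst hpq
      refine contraction_self_mem hM hw ?_
      -- Once the trace of `M` is split off, the first letter takes over the role of `M`.
      obtain ⟨⟨t, a, b⟩, v, rfl⟩ := List.exists_cons_of_ne_nil (List.ne_nil_of_length_eq_add_one hn)
      have := ih v (letterMatrix t) a b (letterMatrix_mem_laxModule t) hw.tail_self
        (by simp [degree, List.countP_cons] at hd ⊢; omega) (by simpa using hn)
      simpa only [eval_cons, contraction] using this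
    -- Otherwise the letter with row `q` is moved to the front, modulo lower degree, and absorbed
    -- into `M`.
    · have hq : q ∈ rows w := by
        have : q ∈ p :: rows w := hw.2.mem_iff.2 (by simp)
        simpa [Ne.symm hpq] using this
      obtain ⟨⟨t, a, r⟩, hl, rfl⟩ := List.mem_map.1 hq
      obtain ⟨v, hv⟩ : ∃ v, w.Perm ((t, a, r) :: v) := by
        classical exact ⟨_, List.perm_cons_erase hl⟩
      have h1 := contraction_sub_mem_of_perm IH M p a hM hv [] hw hd
      have hw' := hw.perm hv
      have h2 : contraction M p a ((t, a, r) :: v) ∈ casimirAlgebra := by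
        refine mem_of_two_nsmul_mem ?_
        rw [two_nsmul_contraction_cons M hpq hw']
        refine ih v _ p r (mul_letterMatrix_mem_laxModule hM t) hw'.tail ?_ ?_
        · have := hv.countP_eq fun l => l.1.isSome
          simp [degree, List.countP_cons] at hd this ⊢; omega
        · have := hv.length_eq
          simp at this; omega
      simpa using add_mem h1 h2

end LaxWord

end Sl2

/-- Expanding a product of sums along a list without repetitions. -/
theorem List.Nodup.smul_sum_prod_map {ι κ R : Type*} [Fintype ι] [DecidableEq ι]
    [Fintype κ] [Ring R]
    [Algebra ℂ R] (F : ι → κ → R) {l : List ι} (hl : l.Nodup) :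
    (Fintype.card κ : ℂ) ^ l.length • ∑ m : ι → κ, (l.map fun p => F p (m p)).prod =
      (Fintype.card κ : ℂ) ^ Fintype.card ι • (l.map fun p => ∑ a, F p a).prod := by
  induction l with
  | nil => simp [← Nat.cast_smul_eq_nsmul ℂ]
  | cons q l ih =>
    obtain ⟨hq, hl⟩ := List.nodup_cons.1 hl
    have e := Fintype.card_nsmul_sum_eq_sum_update q
      fun m : ι → κ => ((q :: l).map fun p => F p (m p)).prod
    have hu (m : ι → κ) (b : κ) : (l.map fun p => F p (Function.update m q b p)) =
        l.map fun p => F p (m p) :=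
      List.map_congr_left fun p hp => by
        rw [Function.update_of_ne (ne_of_mem_of_not_mem hp hq)]
    simp only [List.map_cons, List.prod_cons, Function.update_self, hu, ← Finset.sum_mul,
      ← Finset.mul_sum] at e
    rw [List.length_cons, pow_succ, mul_smul, Nat.cast_smul_eq_nsmul]
    simp only [List.map_cons, List.prod_cons]
    rw [e, ← mul_smul_comm, ih hl, mul_smul_comm]

theorem List.prod_map_smul {ι R : Type*} [Ring R] [Algebra ℂ R] (l : List ι) (c : ι → ℂ)
    (g : ι → R) : (l.map fun p => c p • g p).prod = (l.map c).prod • (l.map g).prod := by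
  induction l with
  | nil => simp
  | cons q l ih => simp [ih, smul_smul, mul_comm]

/-! ### From labels of chords to matrix indices -/

namespace Sl2

theorem sum_pauliHalf (a b : Fin 3) :
    ∑ i : Bool → Fin 2, (2 * pauliHalf a (i true) (i false)) *
      (2 * pauliHalf b (i false) (i true)) = if a = b then 2 else 0 := by
  have h : ∑ i : Bool → Fin 2, (2 * pauliHalf a (i true) (i false)) *
      (2 * pauliHalf b (i false) (i true)) =
      2 * (2 * (pauliHalf a * pauliHalf b).trace) := by
    rw [← (Equiv.boolArrowEquivProd (Fin 2)).symm.sum_comp, Fintype.sum_prod_type]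
    simp [Equiv.boolArrowEquivProd, Matrix.trace_fin_two, Matrix.mul_apply, Fin.sum_univ_two]
    ring
  rw [h]
  have := basis_orthonormal a b
  simp only [basis] at this
  rw [this]
  split_ifs <;> simp

/-- Here the two ends of a chord carry independent labels. The sum factors over chords, and each
factor `2δ` from `sum_pauliHalf` forces the labels at the two ends to agree. -/
theorem sum_prod_pauliHalf {κ : Type*} [Fintype κ] [DecidableEq κ] (m : κ × Bool → Fin 3) :
    ∑ i : κ × Bool → Fin 2, ∏ p, (2 * pauliHalf (m p) (i p) (i (p.1, !p.2))) =
      if ∀ k, m (k, true) = m (k, false) then (2 : ℂ) ^ Fintype.card κ else 0 := by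
  have h := Finset.prod_univ_sum (fun _ : κ => (Finset.univ : Finset (Bool → Fin 2)))
    fun k i => (2 * pauliHalf (m (k, true)) (i true) (i false)) *
      (2 * pauliHalf (m (k, false)) (i false) (i true))
  simp only [sum_pauliHalf, Fintype.piFinset_univ] at h
  rw [← (Equiv.curry κ Bool (Fin 2)).symm.sum_comp]
  simp only [Fintype.prod_prod_type, Fintype.prod_bool]
  refine h.symm.trans ?_
  rw [Finset.prod_ite_zero]
  simp

namespace LaxWord

variable {ι : Type*} [Fintype ι] [DecidableEq ι]

theorem sum_eval_mem (w : LaxWord ι) (hr : (rows w).Nodup) (hc : (rows w).Perm (cols w)) :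
    ∑ i, eval w i ∈ casimirAlgebra := by
  cases w with
  | nil =>
    simp only [eval, List.map_nil, List.prod_nil]
    exact sum_mem fun _ _ => one_mem _
  | cons l w =>
    have := contraction_mem w (letterMatrix l.1) l.2.1 l.2.2 (letterMatrix_mem_laxModule _) ⟨hr, hc⟩
    simpa only [eval_cons, contraction] using this

end LaxWord

open LaxWord in
/-- The sum over labellings of the product of generators along a list in which both ends of every
chord occur exactly once. -/
theorem sum_prod_leg_mem {κ : Type*} [Fintype κ] [DecidableEq κ] (l : List (κ × Bool)) (hl : l.Nodup)
    (hmem : ∀ p, p ∈ l) (s : κ × Bool → Fin 2) :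
    ∑ m : κ → Fin 3, (l.map fun p => leg (s p) (m p.1)).prod ∈ casimirAlgebra := by
  -- The letter at an end has that end as row and the other end of its chord as column, so rows and
  -- columns both exhaust `κ × Bool`.
  let w : LaxWord (κ × Bool) := l.map fun p => (some (s p), p, (p.1, !p.2))
  have hrows : rows w = l := by simp [w, rows, Function.comp_def]
  have hinj : Function.Injective fun p : κ × Bool => (p.1, !p.2) := by
    rintro ⟨a, b⟩ ⟨c, d⟩ h
    simpa using h
  have hcols : cols w = l.map fun p : κ × Bool => (p.1, !p.2) := by
    simp [w, cols, Function.comp_def]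
  have hmemA : ∑ i, eval w i ∈ casimirAlgebra := by
    refine sum_eval_mem w (hrows ▸ hl) ?_
    rw [hrows, hcols, List.perm_ext_iff_of_nodup hl (hl.map hinj)]
    intro p
    simp only [hmem, true_iff, List.mem_map]
    exact ⟨(p.1, !p.2), trivial, by simp⟩
  have hlen : l.length = Fintype.card (κ × Bool) := by
    rw [← List.toFinset_card_of_nodup hl, ← Finset.card_univ]
    congr 1
    ext p
    simp [hmem]
  have heval (i : κ × Bool → Fin 2) : eval w i = ∑ m : κ × Bool → Fin 3,
      (∏ p, (2 * pauliHalf (m p) (i p) (i (p.1, !p.2)))) • (l.map fun p => leg (s p) (m p)).prod := by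
    have h := hl.smul_sum_prod_map fun p (a : Fin 3) =>
      (2 * pauliHalf a (i p) (i (p.1, !p.2))) • leg (s p) a
    rw [hlen] at h
    -- The list contains every end exactly once, so the two powers of 3 are equal and cancel.
    have h3 : ((Fintype.card (Fin 3) : ℂ) ^ Fintype.card (κ × Bool)) ≠ 0 := by simp
    have h' := (IsUnit.mk0 _ h3).smul_left_cancel.1 h
    rw [show eval w i = (l.map fun p => ∑ a, (2 * pauliHalf a (i p) (i (p.1, !p.2))) •
      leg (s p) a).prod by simp [w, eval, letterMatrix, lax, Function.comp_def], ← h']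
    refine Finset.sum_congr rfl fun m _ => ?_
    rw [List.prod_map_smul, ← List.prod_toFinset _ hl]
    congr 2
    ext p
    simp [hmem]
  have hsum : ∑ i, eval w i = (2 : ℂ) ^ Fintype.card κ •
      ∑ m : κ → Fin 3, (l.map fun p => leg (s p) (m p.1)).prod := by
    simp only [heval]
    rw [Finset.sum_comm]
    simp only [← Finset.sum_smul, sum_prod_pauliHalf, ite_smul, zero_smul]
    rw [← Finset.sum_filter, ← Finset.smul_sum]
    congr 1
    refine Finset.sum_nbij' (fun m k => m (k, true)) (fun m p => m p.1) ?_ ?_ ?_ ?_ ?_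
    · simp
    · simp
    · intro m hm
      funext ⟨k, b⟩
      cases b
      · simpa using (Finset.mem_filter.1 hm).2 k
      · rfl
    · simp
    · intro m hm
      refine congrArg List.prod (List.map_congr_left fun p _ => ?_)
      obtain ⟨k, b⟩ := p
      cases b
      · simp [(Finset.mem_filter.1 hm).2 k]
      · rfl
  rw [hsum] at hmemA
  have := casimirAlgebra.smul_mem hmemA ((2 : ℂ) ^ Fintype.card κ)⁻¹
  rwa [smul_smul, inv_mul_cancel₀ (by simp), one_smul] at this

/-! ### Differential operators and algebraic independence -/

section OfTriple

attribute [local instance 100] LieRing.ofAssociativeRing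

variable {T : Type*} [Ring T] [Algebra ℂ T]

/-- The Lie algebra map from `sl₂` to an associative algebra given by three elements with the
commutation relations of the standard basis. -/
def ofTriple (e h f : T) (hef : e * f - f * e = h) (hhe : h * e - e * h = (2 : ℂ) • e)
    (hhf : h * f - f * h = -(2 : ℂ) • f) : Sl2 →ₗ⁅ℂ⁆ T where
  toFun A := A.1 0 1 • e + A.1 1 0 • f + A.1 0 0 • h
  map_add' A B := by simp [add_smul]; abel
  map_smul' r A := by simp [smul_smul]
  map_lie' := by
    intro A B
    have hA : A.1 1 1 = - A.1 0 0 := by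
      have := LinearMap.mem_ker.1 A.2
      simp [Matrix.trace_fin_two] at this
      linear_combination this
    have hB : B.1 1 1 = - B.1 0 0 := by
      have := LinearMap.mem_ker.1 B.2
      simp [Matrix.trace_fin_two] at this
      linear_combination this
    have e1 : e * f = f * e + h := by rw [← hef]; abel
    have e2 : h * e = e * h + (2 : ℂ) • e := by rw [← hhe]; abel
    have e3 : h * f = f * h - (2 : ℂ) • f := by rw [sub_eq_add_neg, ← neg_smul, ← hhf]; abel
    simp only [LieSubalgebra.coe_bracket, Ring.lie_def, Matrix.sub_apply, Matrix.mul_apply,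
      Fin.sum_univ_two, hA, hB, add_mul, mul_add, smul_mul_smul_comm, e1, e2, e3]
    module

end OfTriple

/-- Polynomials in two variables. -/
abbrev Poly : Type := MvPolynomial (Fin 2) ℂ

open MvPolynomial

/-- The raising operator `-∂_s`. -/
def raising (s : Fin 2) : Module.End ℂ Poly := -(pderiv s).toLinearMap

/-- The weight operator `l - 2 y_s ∂_s`. -/
def weightOp (l : ℂ) (s : Fin 2) : Module.End ℂ Poly :=
  LinearMap.mulLeft ℂ (C l) - LinearMap.mulLeft ℂ (2 * X s) * (pderiv s).toLinearMap

/-- The lowering operator `y_s² ∂_s - l y_s`. -/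
def lowering (l : ℂ) (s : Fin 2) : Module.End ℂ Poly :=
  LinearMap.mulLeft ℂ (X s ^ 2) * (pderiv s).toLinearMap - LinearMap.mulLeft ℂ (C l * X s)

theorem raising_apply (s : Fin 2) (p : Poly) : raising s p = -pderiv s p := rfl

theorem weightOp_apply (l : ℂ) (s : Fin 2) (p : Poly) :
    weightOp l s p = C l * p - 2 * X s * pderiv s p := rfl

theorem lowering_apply (l : ℂ) (s : Fin 2) (p : Poly) :
    lowering l s p = X s ^ 2 * pderiv s p - C l * X s * p := rfl

theorem pderiv_comm (p : Poly) : pderiv 0 (pderiv 1 p) = pderiv 1 (pderiv 0 p) := by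
  have : ⁅pderiv (R := ℂ) (0 : Fin 2), pderiv (R := ℂ) (1 : Fin 2)⁆ = 0 := by
    refine MvPolynomial.derivation_ext fun i => ?_
    fin_cases i <;> simp [Derivation.commutator_apply, pderiv_X]
  have h := congrArg (fun D : Derivation ℂ Poly Poly => D p) this
  simpa [Derivation.commutator_apply, sub_eq_zero] using h

theorem pderiv_two (s : Fin 2) : pderiv s (2 : Poly) = 0 := by
  simpa using (pderiv s).map_natCast 2

/-- The representation of `sl₂` with highest weight `l` by differential operators in `y_s`. -/
def diffRep (l : ℂ) (s : Fin 2) : USl2 →ₐ[ℂ] Module.End ℂ Poly :=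
  UniversalEnvelopingAlgebra.lift ℂ <|
    ofTriple (raising s) (weightOp l s) (lowering l s)
      (by
        refine LinearMap.ext fun p => ?_
        simp [raising_apply, weightOp_apply, lowering_apply]
        ring)
      (by
        refine LinearMap.ext fun p => ?_
        simp [raising_apply, weightOp_apply, pderiv_two, smul_eq_C_mul, map_ofNat (C : ℂ →+* Poly)]
        ring)
      (by
        refine LinearMap.ext fun p => ?_
        simp [weightOp_apply, lowering_apply, pderiv_two, smul_eq_C_mul, map_ofNat (C : ℂ →+* Poly)]
        ring)

theorem diffRep_ι (l : ℂ) (s : Fin 2) (y : Sl2) :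
    diffRep l s (UniversalEnvelopingAlgebra.ι ℂ y) = y.1 0 1 • raising s + y.1 1 0 • lowering l s +
      y.1 0 0 • weightOp l s := by
  rw [diffRep, UniversalEnvelopingAlgebra.lift_ι_apply]
  rfl

theorem diffRep_gen (l : ℂ) (s : Fin 2) (a : Fin 3) :
    diffRep l s (gen a) = (basis a).1 0 1 • raising s + (basis a).1 1 0 • lowering l s +
      (basis a).1 0 0 • weightOp l s :=
  diffRep_ι l s _

theorem diffRep_gen_zero (l : ℂ) (s : Fin 2) :
    diffRep l s (gen 0) = (1 / 2 : ℂ) • (raising s + lowering l s) := by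
  simp [diffRep_gen, basis, pauliHalf]

theorem diffRep_gen_one (l : ℂ) (s : Fin 2) :
    diffRep l s (gen 1) = (Complex.I / 2) • (lowering l s - raising s) := by
  simp only [diffRep_gen, basis, pauliHalf, Matrix.cons_val_one, Matrix.smul_apply, Matrix.of_apply,
    Matrix.cons_val', Matrix.cons_val_zero, smul_eq_mul]
  module

theorem diffRep_gen_two (l : ℂ) (s : Fin 2) :
    diffRep l s (gen 2) = (1 / 2 : ℂ) • weightOp l s := by
  simp [diffRep_gen, basis, pauliHalf]

/-- One formula in raising, lowering and weight operators serves both the Casimir element (`s = t`)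
and `x` (`s ≠ t`). -/
theorem diffRep_sum_gen_mul_gen (l m : ℂ) (s t : Fin 2) :
    ∑ a, diffRep l s (gen a) * diffRep m t (gen a) = (1 / 4 : ℂ) •
      ((2 : ℂ) • (raising s * lowering m t + lowering l s * raising t) +
        weightOp l s * weightOp m t) := by
  have hI : Complex.I / 2 * (Complex.I / 2) = -(1 / 4) := by
    linear_combination (1 / 4) * Complex.I_mul_I
  rw [Fin.sum_univ_three, diffRep_gen_zero, diffRep_gen_zero, diffRep_gen_one, diffRep_gen_one,
    diffRep_gen_two, diffRep_gen_two, smul_mul_smul_comm, smul_mul_smul_comm, smul_mul_smul_comm,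
    hI]
  simp only [mul_add, add_mul, mul_sub, sub_mul]
  module

theorem diffRep_casimir (l : ℂ) (s : Fin 2) (p : Poly) :
    diffRep l s casimir p = (l * (l + 2) / 4) • p := by
  have h : diffRep l s casimir = ∑ a, diffRep l s (gen a) * diffRep l s (gen a) := by
    simp [casimir, pow_two]
  rw [h, diffRep_sum_gen_mul_gen, LinearMap.smul_apply,
    show l * (l + 2) / 4 = 1 / 4 * (l * (l + 2)) by ring, mul_smul]
  congr 1
  simp [raising_apply, weightOp_apply, lowering_apply, smul_eq_C_mul, pderiv_two,
    map_ofNat (C : ℂ →+* Poly)]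
  ring

section

attribute [local instance 100] LieRing.ofAssociativeRing

/-- An algebra map out of `U(sl₂)` that commutes with an element on the generators does so
everywhere. -/
theorem commute_of_commute_ι {T : Type*} [Ring T] [Algebra ℂ T] (φ : USl2 →ₐ[ℂ] T) (t : T)
    (h : ∀ y : Sl2, Commute (φ (UniversalEnvelopingAlgebra.ι ℂ y)) t) (u : USl2) :
    Commute (φ u) t := by
  let S : Subalgebra ℂ USl2 := (Subalgebra.centralizer ℂ {t}).comap φ
  let j : Sl2 →ₗ⁅ℂ⁆ S :=
    { toFun y := ⟨UniversalEnvelopingAlgebra.ι ℂ y, by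
        rw [Subalgebra.mem_comap, Subalgebra.mem_centralizer_iff]
        rintro _ rfl
        exact (h y).eq.symm⟩
      map_add' y z := Subtype.ext (by simp)
      map_smul' r y := Subtype.ext (by simp)
      map_lie' := Subtype.ext (LieHom.map_lie _ _ _) }
  -- By the universal property the identity of `U(sl₂)` factors through `S`, so `S` is everything.
  have hj : S.val.comp (UniversalEnvelopingAlgebra.lift ℂ j) = AlgHom.id ℂ USl2 := by
    refine UniversalEnvelopingAlgebra.hom_ext ℂ (LieHom.ext fun y => ?_)
    change S.val (UniversalEnvelopingAlgebra.lift ℂ j (UniversalEnvelopingAlgebra.ι ℂ y)) = _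
    rw [UniversalEnvelopingAlgebra.lift_ι_apply]
    rfl
  have hu := (UniversalEnvelopingAlgebra.lift ℂ j u).2
  change S.val.comp (UniversalEnvelopingAlgebra.lift ℂ j) u ∈ S at hu
  rw [hj, AlgHom.id_apply, Subalgebra.mem_comap, Subalgebra.mem_centralizer_iff] at hu
  exact (hu t rfl).symm

end

theorem diffRep_commute (l m : ℂ) (u v : USl2) : Commute (diffRep l 0 u) (diffRep m 1 v) := by
  refine commute_of_commute_ι _ _ (fun y => ?_) u
  refine (commute_of_commute_ι _ _ (fun z => ?_) v).symm
  rw [commute_iff_eq, diffRep_ι, diffRep_ι]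
  refine LinearMap.ext fun p => ?_
  simp [raising_apply, weightOp_apply, lowering_apply, smul_eq_C_mul, pderiv_two,
    pderiv_comm]
  ring

/-- The representation of `U(sl₂) ⊗ U(sl₂)` by differential operators in two variables. -/
def diffRepTensor (l m : ℂ) : USl2 ⊗[ℂ] USl2 →ₐ[ℂ] Module.End ℂ Poly :=
  Algebra.TensorProduct.lift (diffRep l 0) (diffRep m 1) (diffRep_commute l m)

theorem diffRepTensor_c₁ (l m : ℂ) (p : Poly) :
    diffRepTensor l m c₁ p = (l * (l + 2) / 4) • p := by
  simp [diffRepTensor, c₁, diffRep_casimir]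

theorem diffRepTensor_c₂ (l m : ℂ) (p : Poly) :
    diffRepTensor l m c₂ p = (m * (m + 2) / 4) • p := by
  simp [diffRepTensor, c₂, diffRep_casimir]

theorem pderiv_sub_pow (k : ℕ) :
    pderiv (0 : Fin 2) ((X 0 - X 1 : Poly) ^ k) = (k : Poly) * (X 0 - X 1) ^ (k - 1) ∧
      pderiv (1 : Fin 2) ((X 0 - X 1 : Poly) ^ k) = -((k : Poly) * (X 0 - X 1) ^ (k - 1)) := by
  constructor <;> rw [Derivation.leibniz_pow]
  · simp
  · simp

/-- The sum of the two raising operators kills `(y_0 - y_1)^k`, a vector of weight `l + m - 2k`. The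
total Casimir element is `c₁ + c₂ + 2x`, which explains the eigenvalue; the proof computes it
directly. -/
theorem diffRepTensor_x (l m : ℂ) (k : ℕ) :
    diffRepTensor l m x ((X 0 - X 1) ^ k) =
      (l * m / 4 + k * (k - (l + m + 1)) / 2) • ((X 0 - X 1 : Poly) ^ k) := by
  have h : diffRepTensor l m x = ∑ a, diffRep l 0 (gen a) * diffRep m 1 (gen a) := by
    simp [x, diffRepTensor]
  -- Naming the derivative `w` and keeping only `(y_0 - y_1) w = k (y_0 - y_1)^k` avoids the
  -- truncated exponent `k - 1` and covers `k = 0`.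
  obtain ⟨w, hw0, hw1, hw⟩ : ∃ w : Poly, pderiv (0 : Fin 2) ((X 0 - X 1 : Poly) ^ k) = w ∧
      pderiv (1 : Fin 2) ((X 0 - X 1 : Poly) ^ k) = -w ∧ (X 0 - X 1) * w = (k : Poly) * (X 0 - X 1) ^ k := by
    refine ⟨_, (pderiv_sub_pow k).1, (pderiv_sub_pow k).2, ?_⟩
    cases k with
    | zero => simp
    | succ k => simp; ring
  have hw' : (X 0 - X 1) * pderiv 0 w = ((k : Poly) - 1) * w := by
    have := congrArg (pderiv (0 : Fin 2)) hw
    simp [hw0] at this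
    linear_combination this
  rw [h, diffRep_sum_gen_mul_gen, LinearMap.smul_apply,
    show l * m / 4 + k * (k - (l + m + 1)) / 2 = 1 / 4 * (l * m + 2 * (k * (k - (l + m + 1)))) by ring,
    mul_smul]
  congr 1
  simp [raising_apply, weightOp_apply, lowering_apply, smul_eq_C_mul, pderiv_two,
    map_ofNat (C : ℂ →+* Poly), hw0, hw1]
  linear_combination 2 * (X 0 - X 1) * hw' + (2 * ((k : Poly) - 1) - 2 * (C l + C m)) * hw

theorem algHom_diffRepTensor {φ : MvPolynomial (Fin 3) ℂ →ₐ[ℂ] USl2 ⊗[ℂ] USl2}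
    (h0 : φ (X 0) = c₁) (h1 : φ (X 1) = c₂) (h2 : φ (X 2) = x) (l m : ℂ) (k : ℕ)
    (p : MvPolynomial (Fin 3) ℂ) :
    diffRepTensor l m (φ p) ((X 0 - X 1) ^ k) =
      eval ![l * (l + 2) / 4, m * (m + 2) / 4, l * m / 4 + k * (k - (l + m + 1)) / 2] p •
        ((X 0 - X 1 : Poly) ^ k) := by
  induction p using MvPolynomial.induction_on with
  | C a =>
    rw [eval_C, ← algebraMap_eq, AlgHom.commutes, AlgHom.commutes, Module.algebraMap_end_apply]
  | add p q hp hq => simp only [map_add, LinearMap.add_apply, hp, hq, add_smul]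
  | mul_X p i hp =>
    simp only [map_mul, Module.End.mul_apply, eval_X]
    fin_cases i
    · simp [h0, diffRepTensor_c₁, hp, smul_smul, mul_comm]
    · simp [h1, diffRepTensor_c₂, hp, smul_smul, mul_comm]
    · simp [h2, diffRepTensor_x, hp, smul_smul, mul_comm]

theorem exists_quadratic_eq (b c : ℂ) : ∃ z : ℂ, z * (z + b) = c := by
  obtain ⟨s, hs⟩ := IsAlgClosed.exists_pow_nat_eq (c + b ^ 2 / 4) (n := 2) (by norm_num)
  exact ⟨s - b / 2, by linear_combination hs⟩

/-- The elements `c₁, c₂, x` are algebraically independent. -/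
theorem algHom_injective {φ : MvPolynomial (Fin 3) ℂ →ₐ[ℂ] USl2 ⊗[ℂ] USl2}
    (h0 : φ (X 0) = c₁) (h1 : φ (X 1) = c₂) (h2 : φ (X 2) = x) : Function.Injective φ := by
  refine (injective_iff_map_eq_zero φ).2 fun p hp => MvPolynomial.funext fun v => ?_
  -- The parameters `l, m, t` are chosen so that the three eigenvalues, with `t` in place of `k`,
  -- are the coordinates of the given point `v`.
  obtain ⟨l, hl⟩ := exists_quadratic_eq 2 (4 * v 0)
  obtain ⟨m, hm⟩ := exists_quadratic_eq 2 (4 * v 1)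
  obtain ⟨t, ht⟩ := exists_quadratic_eq (-(l + m + 1)) (2 * (v 2 - l * m / 4))
  let g : Fin 3 → Polynomial ℂ := ![.C (l * (l + 2) / 4), .C (m * (m + 2) / 4),
    .C (l * m / 4) + .X * (.X - .C (l + m + 1)) * .C (1 / 2)]
  have hg (z : ℂ) : (aeval g p).eval z =
      eval ![l * (l + 2) / 4, m * (m + 2) / 4, l * m / 4 + z * (z - (l + m + 1)) / 2] p := by
    have := congrArg (fun f : MvPolynomial (Fin 3) ℂ →ₐ[ℂ] ℂ => f p)
      (MvPolynomial.algHom_ext (f := (Polynomial.aeval z).comp (aeval g)) (g := aeval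
        ![l * (l + 2) / 4, m * (m + 2) / 4, l * m / 4 + z * (z - (l + m + 1)) / 2]) fun i => by
          fin_cases i <;> simp [g, div_eq_mul_inv])
    simpa [Polynomial.coe_aeval_eq_eval, aeval_eq_eval] using this
  -- At each natural `k` the nonzero vector `(y_0 - y_1)^k` forces the value to vanish, and a
  -- one-variable polynomial with infinitely many roots is zero.
  have hz : aeval g p = 0 := by
    refine Polynomial.eq_zero_of_infinite_isRoot _ ((Set.infinite_range_of_injective
      (Nat.cast_injective (R := ℂ))).mono ?_)
    rintro _ ⟨k, rfl⟩
    have hk := algHom_diffRepTensor h0 h1 h2 l m k p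
    rw [hp, map_zero, LinearMap.zero_apply, eq_comm, smul_eq_zero] at hk
    rw [Set.mem_ofPred_eq, Polynomial.IsRoot, hg]
    refine hk.resolve_right (pow_ne_zero _ (sub_ne_zero.2 fun h => ?_))
    exact absurd (X_injective h) (by decide)
  have := hg t
  rw [hz, Polynomial.eval_zero] at this
  rw [map_zero, this]
  congr 2
  funext i
  fin_cases i
  · simp [hl]
  · simp [hm]
  · simp only [Fin.reduceFinMk, Matrix.cons_val]
    linear_combination -ht / 2

open scoped IsMulCommutative in
/-- The algebra map from polynomials in three variables to the subalgebra generated by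
`c₁, c₂, x`. -/
theorem exists_algHom_adjoin :
    ∃ ψ : MvPolynomial (Fin 3) ℂ →ₐ[ℂ]
      Algebra.adjoin ℂ ({c₁, c₂, x} : Set (USl2 ⊗[ℂ] USl2)),
      (ψ (X 0) : USl2 ⊗[ℂ] USl2) = c₁ ∧ (ψ (X 1) : USl2 ⊗[ℂ] USl2) = c₂ ∧
        (ψ (X 2) : USl2 ⊗[ℂ] USl2) = x := by
  have hcomm : ∀ a ∈ ({c₁, c₂, x} : Set (USl2 ⊗[ℂ] USl2)),
      ∀ b ∈ ({c₁, c₂, x} : Set (USl2 ⊗[ℂ] USl2)), a * b = b * a := by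
    have h12 := commute_c₁_c₂.eq
    have h1x := commute_c₁_x.eq
    have h2x := commute_c₂_x.eq
    rintro a (rfl | rfl | rfl) b (rfl | rfl | rfl) <;> simp only [h12, h1x, h2x]
  -- `aeval` needs a commutative target, so the map is built into the subalgebra and not into the
  -- tensor product.
  have := Algebra.isMulCommutative_adjoin ℂ hcomm
  refine ⟨aeval ![⟨c₁, Algebra.subset_adjoin (by simp)⟩, ⟨c₂, Algebra.subset_adjoin (by simp)⟩,
    ⟨x, Algebra.subset_adjoin (by simp)⟩], ?_, ?_, ?_⟩ <;> simp

/-- The subalgebra generated by `c₁, c₂, x` is a polynomial ring in these elements. -/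
theorem exists_algEquiv_adjoin :
    ∃ e : MvPolynomial (Fin 3) ℂ ≃ₐ[ℂ] Algebra.adjoin ℂ ({c₁, c₂, x} : Set (USl2 ⊗[ℂ] USl2)),
      (e (X 0) : USl2 ⊗[ℂ] USl2) = c₁ ∧ (e (X 1) : USl2 ⊗[ℂ] USl2) = c₂ ∧
        (e (X 2) : USl2 ⊗[ℂ] USl2) = x := by
  obtain ⟨ψ, h0, h1, h2⟩ := exists_algHom_adjoin
  refine ⟨AlgEquiv.ofBijective ψ ⟨?_, ?_⟩, h0, h1, h2⟩
  · exact fun p q hpq =>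
      algHom_injective (φ := (Subalgebra.val _).comp ψ) h0 h1 h2 (congrArg Subtype.val hpq)
  · rintro ⟨z, hz⟩
    have hle : Algebra.adjoin ℂ {c₁, c₂, x} ≤ ((Subalgebra.val _).comp ψ).range := by
      refine Algebra.adjoin_le ?_
      rintro _ (rfl | rfl | rfl)
      exacts [⟨X 0, h0⟩, ⟨X 1, h1⟩, ⟨X 2, h2⟩]
    obtain ⟨p, hp⟩ := hle hz
    exact ⟨p, Subtype.ext hp⟩

end Sl2

/-! ### Chords and their labelled ends -/

namespace ChordDiagram

variable {k : ℕ} (D : ChordDiagram k)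

theorem sameCycle_partner_iff (p q : D.Endpoint) :
    D.partner.SameCycle p q ↔ q = p ∨ q = D.partner p := by
  have h2 : D.partner ^ (2 : ℤ) = 1 := by
    ext1 p
    exact D.partner_partner p
  constructor
  · rintro ⟨n, rfl⟩
    obtain ⟨j, rfl | rfl⟩ := Int.even_or_odd' n
    · left; rw [zpow_mul, h2, one_zpow]; rfl
    · right; rw [zpow_add, zpow_mul, h2, one_zpow, one_mul, zpow_one]
  · rintro (rfl | rfl)
    · exact Equiv.Perm.SameCycle.refl _ _
    · exact ⟨1, by simp⟩

theorem chordAt_eq_iff (p q : D.Endpoint) :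
    D.chordAt p = D.chordAt q ↔ q = p ∨ q = D.partner p :=
  Quotient.eq.trans (D.sameCycle_partner_iff p q)

theorem chordAt_partner (p : D.Endpoint) : D.chordAt (D.partner p) = D.chordAt p :=
  ((D.chordAt_eq_iff _ _).2 (Or.inr rfl)).symm

theorem exists_chordAt_eq (c : D.Chord) : ∃ p, D.chordAt p = c := Quotient.exists_rep c

/-- The two ends of every chord can be told apart. -/
theorem exists_endpoint_equiv : ∃ e : D.Endpoint ≃ D.Chord × Bool,
    (∀ p, (e p).1 = D.chordAt p) ∧ ∀ p, e (D.partner p) = ((e p).1, !(e p).2) := by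
  classical
  -- An arbitrary representative of each chord is declared to be its `true` end.
  choose r hr using D.exists_chordAt_eq
  have hflip (p : D.Endpoint) : (D.partner p = r (D.chordAt p)) ↔ p ≠ r (D.chordAt p) := by
    rcases (D.chordAt_eq_iff p (r (D.chordAt p))).1 (hr _).symm with h | h
    · rw [h]
      simp [D.partner_ne]
    · rw [h]
      simp [(D.partner_ne p).symm]
  let f : D.Endpoint → D.Chord × Bool := fun p => (D.chordAt p, decide (p = r (D.chordAt p)))
  have hf (p : D.Endpoint) : f (D.partner p) = ((f p).1, !(f p).2) := by
    simp only [f, D.chordAt_partner, hflip, Prod.mk.injEq, true_and]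
    simp
  have hbij : Function.Bijective f := by
    constructor
    · intro p q h
      have h1 : D.chordAt p = D.chordAt q := congrArg Prod.fst h
      rcases (D.chordAt_eq_iff p q).1 h1 with h' | h'
      · exact h'.symm
      · rw [h', hf] at h
        exact absurd (congrArg Prod.snd h) (by simp)
    · rintro ⟨c, b⟩
      have hc : f (r c) = (c, true) := by simp [f, hr]
      cases b
      · exact ⟨D.partner (r c), by rw [hf, hc]; rfl⟩
      · exact ⟨r c, hc⟩
  exact ⟨Equiv.ofBijective f hbij, fun _ => rfl, hf⟩

/-- The diagram in which the two ends of the chord `c` are the endpoints matched with `(c, true)`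
and `(c, false)`. -/
def ofEquiv {κ : Type*} (points : Fin k → ℕ) (e : (Σ i, Fin (points i)) ≃ κ × Bool) :
    ChordDiagram k where
  points := points
  partner := (e.trans (Equiv.prodCongr (Equiv.refl κ) Equiv.boolNot)).trans e.symm
  partner_partner p := e.injective (by
    simp only [Equiv.trans_apply, Equiv.apply_symm_apply, Equiv.prodCongr_apply, Equiv.coe_refl]
    exact Prod.ext rfl (Bool.not_not _))
  partner_ne p h := by
    have := congrArg (fun q => (e q).2) h
    simp at this

section

variable {κ : Type*} (points : Fin k → ℕ) (e : (Σ i, Fin (points i)) ≃ κ × Bool)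

theorem ofEquiv_partner (p : (ofEquiv points e).Endpoint) :
    e ((ofEquiv points e).partner p) = ((e p).1, !(e p).2) :=
  e.apply_symm_apply _

/-- The chords of `ofEquiv points e` are the labels. -/
theorem exists_chord_equiv_ofEquiv :
    ∃ f : (ofEquiv points e).Chord ≃ κ, ∀ p, f ((ofEquiv points e).chordAt p) = (e p).1 := by
  set D := ofEquiv points e
  have hD (p : D.Endpoint) : e (D.partner p) = ((e p).1, !(e p).2) := ofEquiv_partner points e p
  let f : D.Chord → κ := Quotient.lift (fun p : D.Endpoint => (e p).1) fun p q h => by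
    rcases (D.sameCycle_partner_iff p q).1 h with rfl | rfl
    · rfl
    · rw [hD]
  refine ⟨Equiv.ofBijective f ⟨fun c c' h => ?_, fun a => ?_⟩, fun p => rfl⟩
  · obtain ⟨p, rfl⟩ := D.exists_chordAt_eq c
    obtain ⟨q, rfl⟩ := D.exists_chordAt_eq c'
    have h' : (e p).1 = (e q).1 := h
    rw [D.chordAt_eq_iff]
    by_cases hb : (e p).2 = (e q).2
    · exact Or.inl (e.injective (Prod.ext h' hb)).symm
    · refine Or.inr (e.injective ?_)
      rw [hD]
      exact Prod.ext h'.symm (by revert hb; cases (e p).2 <;> cases (e q).2 <;> simp)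
  · exact ⟨D.chordAt (e.symm (a, true)), congrArg Prod.fst (e.apply_symm_apply (a, true))⟩

theorem weight_ofEquiv {L : Type*} [LieRing L] [LieAlgebra ℂ L] {d : ℕ} (b : Fin d → L)
    [Fintype κ] [DecidableEq κ]
    (points : Fin 2 → ℕ) (e : (Σ i, Fin (points i)) ≃ κ × Bool) :
    weight b (ofEquiv points e) = ∑ m : κ → Fin d,
      (List.ofFn fun j => UniversalEnvelopingAlgebra.ι ℂ (b (m (e ⟨0, j⟩).1))).prod ⊗ₜ[ℂ]
        (List.ofFn fun j => UniversalEnvelopingAlgebra.ι ℂ (b (m (e ⟨1, j⟩).1))).prod := by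
  obtain ⟨f, hf⟩ := exists_chord_equiv_ofEquiv points e
  rw [weight, ← (Equiv.arrowCongr f (Equiv.refl (Fin d))).symm.sum_comp]
  refine Finset.sum_congr rfl fun m _ => ?_
  simp [strandProduct, hf, Equiv.arrowCongr]
  rfl

end

end ChordDiagram

/-! ### The image of the weight system -/

namespace Sl2

theorem prod_ofFn_leg_zero {n : ℕ} (f : Fin n → Fin 3) :
    (List.ofFn fun j => leg 0 (f j)).prod = (List.ofFn fun j => gen (f j)).prod ⊗ₜ 1 := by
  have := map_list_prod (Algebra.TensorProduct.includeLeft (R := ℂ) (S := ℂ) (A := USl2) (B := USl2))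
    (List.ofFn fun j => gen (f j))
  rw [List.map_ofFn] at this
  exact this.symm

theorem prod_ofFn_leg_one {n : ℕ} (f : Fin n → Fin 3) :
    (List.ofFn fun j => leg 1 (f j)).prod = 1 ⊗ₜ (List.ofFn fun j => gen (f j)).prod := by
  have := map_list_prod (Algebra.TensorProduct.includeRight (R := ℂ) (A := USl2) (B := USl2))
    (List.ofFn fun j => gen (f j))
  rw [List.map_ofFn] at this
  exact this.symm

theorem weight_mem (D : ChordDiagram 2) : ChordDiagram.weight basis D ∈ casimirAlgebra := by
  obtain ⟨e, he, -⟩ := D.exists_endpoint_equiv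
  -- Reading the first strand and then the second turns the tensor of strand products into one
  -- product of `leg` factors.
  let l : List (D.Chord × Bool) :=
    (List.ofFn fun j => e ⟨0, j⟩) ++ List.ofFn fun j => e ⟨1, j⟩
  have hl : l.Nodup := by
    refine List.Nodup.append ?_ ?_ ?_
    · exact List.nodup_ofFn.2 (e.injective.comp sigma_mk_injective)
    · exact List.nodup_ofFn.2 (e.injective.comp sigma_mk_injective)
    · simp [List.disjoint_left, List.mem_ofFn]
  have hmem (p : D.Chord × Bool) : p ∈ l := by
    obtain ⟨⟨i, j⟩, rfl⟩ := e.surjective p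
    fin_cases i
    · exact List.mem_append_left _ (List.mem_ofFn.2 ⟨j, rfl⟩)
    · exact List.mem_append_right _ (List.mem_ofFn.2 ⟨j, rfl⟩)
  have h := sum_prod_leg_mem l hl hmem fun p => (e.symm p).1
  convert h using 1
  refine Finset.sum_congr rfl fun m _ => ?_
  simp only [l, List.map_append, List.map_ofFn, List.prod_append, Function.comp_def,
    Equiv.symm_apply_apply, prod_ofFn_leg_zero, prod_ofFn_leg_one, he,
    Algebra.TensorProduct.tmul_mul_tmul, one_mul, mul_one]
  rfl

theorem sum_prod_ofFn {R : Type*} [Ring R] [Algebra ℂ R] (f : Fin 3 → R) (n : ℕ) :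
    ∑ m : Fin n → Fin 3, (List.ofFn fun i => f (m i)).prod = (∑ a, f a) ^ n := by
  have := (MultilinearMap.mkPiAlgebraFin ℂ n R).map_sum fun _ a => f a
  simpa using this.symm

theorem prod_ofFn_tmul {n : ℕ} (f g : Fin n → USl2) :
    (List.ofFn f).prod ⊗ₜ[ℂ] (List.ofFn g).prod = (List.ofFn fun i => f i ⊗ₜ[ℂ] g i).prod := by
  induction n with
  | zero => simp [Algebra.TensorProduct.one_def]
  | succ n ih => simp [List.ofFn_succ, ← ih]

/-- The first `2 a` points in consecutive pairs, followed by `k` single points. -/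
def pairsEquiv (a k : ℕ) : Fin (a * 2 + k) ≃ (Fin a × Bool) ⊕ Fin k :=
  finSumFinEquiv.symm.trans (Equiv.sumCongr (finProdFinEquiv.symm.trans
    (Equiv.prodCongr (Equiv.refl _) finTwoEquiv)) (Equiv.refl _))

theorem prod_ofFn_pairsEquiv {R : Type*} [Ring R] (a k : ℕ) (G : (Fin a × Bool) ⊕ Fin k → R) :
    (List.ofFn fun j => G (pairsEquiv a k j)).prod =
      (List.ofFn fun i => G (.inl (i, false)) * G (.inl (i, true))).prod *
        (List.ofFn fun j => G (.inr j)).prod := by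
  rw [List.ofFn_add, List.prod_append, List.ofFn_mul, List.prod_flatten, List.map_ofFn]
  have h1 (i : Fin a) (j : Fin 2) (h : (i * 2 + j : ℕ) < a * 2) :
      pairsEquiv a k (Fin.castLE (Nat.le_add_right _ _) ⟨i * 2 + j, h⟩) =
        .inl (i, finTwoEquiv j) := by
    rw [← Equiv.eq_symm_apply]
    ext
    simp [pairsEquiv]
    ring
  have h2 (j : Fin k) : pairsEquiv a k (Fin.natAdd _ j) = .inr j := by
    rw [← Equiv.eq_symm_apply]
    rfl
  congr 2
  · congr 1
    funext i
    simp only [Function.comp_apply, h1]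
    simp [List.ofFn_succ]
    rfl
  · simp only [h2]

/-- The equivalence describing the diagram with `a` isolated chords on the first strand, `b` on the
second strand, and `k` parallel chords between the strands. -/
def monomialEquiv (a b k : ℕ) :
    (Σ i : Fin 2, Fin (![a * 2 + k, b * 2 + k] i)) ≃ (Fin a ⊕ Fin b ⊕ Fin k) × Bool where
  toFun
    | ⟨0, j⟩ => match pairsEquiv a k j with
      | .inl (i, t) => (.inl i, t)
      | .inr i => (.inr (.inr i), false)
    | ⟨1, j⟩ => match pairsEquiv b k j with
      | .inl (i, t) => (.inr (.inl i), t)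
      | .inr i => (.inr (.inr i), true)
  invFun
    | (.inl i, t) => ⟨0, (pairsEquiv a k).symm (.inl (i, t))⟩
    | (.inr (.inl i), t) => ⟨1, (pairsEquiv b k).symm (.inl (i, t))⟩
    | (.inr (.inr i), false) => ⟨0, (pairsEquiv a k).symm (.inr i)⟩
    | (.inr (.inr i), true) => ⟨1, (pairsEquiv b k).symm (.inr i)⟩
  left_inv := by
    rintro ⟨i, j⟩
    fin_cases i
    · obtain ⟨z, rfl⟩ := (pairsEquiv a k).symm.surjective j
      rcases z with ⟨i, t⟩ | i <;> simp
    · obtain ⟨z, rfl⟩ := (pairsEquiv b k).symm.surjective j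
      rcases z with ⟨i, t⟩ | i <;> simp
  right_inv := by
    rintro ⟨i | i | i, _ | _⟩ <;> simp

/-- Each isolated chord has adjacent ends and contributes a Casimir element. The parallel chords
meet both strands in the same order, after all isolated ones, so they contribute `x ^ k` on the
right. -/
theorem weight_monomialEquiv (a b k : ℕ) :
    ChordDiagram.weight basis (ChordDiagram.ofEquiv _ (monomialEquiv a b k)) =
      c₁ ^ a * c₂ ^ b * x ^ k := by
  have h0 (m : Fin a ⊕ Fin b ⊕ Fin k → Fin 3) :
      (List.ofFn fun j => gen (m (monomialEquiv a b k ⟨0, j⟩).1)).prod =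
        (List.ofFn fun i => gen (m (.inl i)) ^ 2).prod *
          (List.ofFn fun i => gen (m (.inr (.inr i)))).prod := by
    simp only [pow_two]
    refine Eq.trans ?_ (prod_ofFn_pairsEquiv a k (Sum.elim (fun z => gen (m (.inl z.1)))
      fun i => gen (m (.inr (.inr i)))))
    congr 2
    funext j
    simp only [monomialEquiv, Equiv.coe_fn_mk]
    cases pairsEquiv a k j <;> rfl
  have h1 (m : Fin a ⊕ Fin b ⊕ Fin k → Fin 3) :
      (List.ofFn fun j => gen (m (monomialEquiv a b k ⟨1, j⟩).1)).prod =
        (List.ofFn fun i => gen (m (.inr (.inl i))) ^ 2).prod *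
          (List.ofFn fun i => gen (m (.inr (.inr i)))).prod := by
    simp only [pow_two]
    refine Eq.trans ?_ (prod_ofFn_pairsEquiv b k (Sum.elim (fun z => gen (m (.inr (.inl z.1))))
      fun i => gen (m (.inr (.inr i)))))
    congr 2
    funext j
    simp only [monomialEquiv, Equiv.coe_fn_mk]
    cases pairsEquiv b k j <;> rfl
  have hA : c₁ ^ a = ∑ m : Fin a → Fin 3, (List.ofFn fun i => gen (m i) ^ 2).prod ⊗ₜ[ℂ] 1 := by
    rw [← TensorProduct.sum_tmul, sum_prod_ofFn (fun a => gen a ^ 2), c₁,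
      Algebra.TensorProduct.tmul_pow, one_pow, casimir]
  have hB : c₂ ^ b = ∑ m : Fin b → Fin 3, 1 ⊗ₜ[ℂ] (List.ofFn fun i => gen (m i) ^ 2).prod := by
    rw [← TensorProduct.tmul_sum, sum_prod_ofFn (fun a => gen a ^ 2), c₂,
      Algebra.TensorProduct.tmul_pow, one_pow, casimir]
  have hX : x ^ k = ∑ m : Fin k → Fin 3, (List.ofFn fun i => gen (m i)).prod ⊗ₜ[ℂ]
      (List.ofFn fun i => gen (m i)).prod := by
    simp only [prod_ofFn_tmul]
    rw [sum_prod_ofFn (fun a => gen a ⊗ₜ[ℂ] gen a), x]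
  rw [ChordDiagram.weight_ofEquiv]
  change ∑ m : Fin a ⊕ Fin b ⊕ Fin k → Fin 3,
    (List.ofFn fun j => gen (m (monomialEquiv a b k ⟨0, j⟩).1)).prod ⊗ₜ[ℂ]
      (List.ofFn fun j => gen (m (monomialEquiv a b k ⟨1, j⟩).1)).prod = _
  simp only [h0, h1]
  rw [← (Equiv.sumArrowEquivProdArrow _ _ _).symm.sum_comp, Fintype.sum_prod_type, hA, hB, hX,
    mul_assoc, Finset.sum_mul]
  refine Finset.sum_congr rfl fun m₀ _ => ?_
  rw [← (Equiv.sumArrowEquivProdArrow _ _ _).symm.sum_comp, Fintype.sum_prod_type,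
    Finset.sum_mul, Finset.mul_sum]
  refine Finset.sum_congr rfl fun m₁ _ => ?_
  rw [Finset.mul_sum, Finset.mul_sum]
  refine Finset.sum_congr rfl fun m₂ _ => ?_
  simp [Equiv.sumArrowEquivProdArrow]

theorem range_weightSystem :
    LinearMap.range weightSystem = Subalgebra.toSubmodule casimirAlgebra := by
  refine le_antisymm ?_ ?_
  · rw [weightSystem, ChordDiagram.weightSystem, Finsupp.range_linearCombination, Submodule.span_le]
    rintro _ ⟨D, rfl⟩
    exact weight_mem D
  · intro z hz
    -- Only surjectivity of `e` matters here: every element is a combination of monomials, and each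
    -- monomial is the weight of a diagram.
    obtain ⟨e, h0, h1, h2⟩ := exists_algEquiv_adjoin
    obtain ⟨p, hp⟩ := e.surjective ⟨z, hz⟩
    have hz' : z = (Subalgebra.val _).comp e.toAlgHom p := (congrArg Subtype.val hp).symm
    rw [hz', p.as_sum, map_sum]
    refine Submodule.sum_mem _ fun d _ => ?_
    refine ⟨Finsupp.single (ChordDiagram.ofEquiv _ (monomialEquiv (d 0) (d 1) (d 2))) (p.coeff d), ?_⟩
    rw [weightSystem, ChordDiagram.weightSystem, Finsupp.linearCombination_single,
      weight_monomialEquiv, MvPolynomial.monomial_eq, map_mul, ← MvPolynomial.algebraMap_eq,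
      AlgHom.commutes, Algebra.smul_def, Finsupp.prod_fintype _ _ (by simp), Fin.prod_univ_three]
    simp [h0, h1, h2]

end Sl2

end

/-- The image of the `sl₂` weight system on chord diagrams on two strands is the subalgebra of
`U(sl₂) ⊗ U(sl₂)` generated by `c₁, c₂, x`, and this subalgebra is the polynomial ring in these
three elements: they commute and are algebraically independent. -/
theorem mainTheorem5 :
    LinearMap.range Sl2.weightSystem =
        Subalgebra.toSubmodule (Algebra.adjoin ℂ ({Sl2.c₁, Sl2.c₂, Sl2.x} :
          Set (USl2 ⊗[ℂ] USl2))) ∧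
      ∃ e : MvPolynomial (Fin 3) ℂ ≃ₐ[ℂ]
          Algebra.adjoin ℂ ({Sl2.c₁, Sl2.c₂, Sl2.x} : Set (USl2 ⊗[ℂ] USl2)),
        (e (MvPolynomial.X 0) : USl2 ⊗[ℂ] USl2) = Sl2.c₁ ∧
        (e (MvPolynomial.X 1) : USl2 ⊗[ℂ] USl2) = Sl2.c₂ ∧
        (e (MvPolynomial.X 2) : USl2 ⊗[ℂ] USl2) = Sl2.x :=
  ⟨Sl2.range_weightSystem, Sl2.exists_algEquiv_adjoin⟩
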